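/- Let $\Sigma=\{a,b,c\}$. The state complexity of a regular language over $\Sigma$ is the number of states of its minimal complete deterministic finite automaton (DFA), $L^R$ is the set of reversals of the words of $L$, and $\oplus$ is symmetric difference. For $n\ge 3$ and $F\subseteq\{0,\dots,n-1\}$, let $\mathcal U_{F,n}(a,b,c)$ be the DFA with states $0,\dots,n-1$, initial state $0$ and set of final states $F$, in which $a$ acts as the cycle $(0,1,\dots,n-1)$, $b$ acts as the transposition $(0,1)$, and $c$ sends $n-1$ to $0$ and fixes all other states. Let $U_{F,n}(a,b,c)$ be its language, let $U_{F,n}(b,a,c)$ be the language of the DFA obtained from it by interchanging the roles of the letters $a$ and $b$, and put $U_n(a,b,c)=U_{\{n-1\},n}(a,b,c)$, $U_n(b,a,c)=U_{\{n-1\},n}(b,a,c)$. 1. Let $K_m=U_{\{0,2\},m}(a,b,c)$ for $m\ge 3$, $L_n=U_{\{1,3\},n}(b,a,c)$ for $n\ge 4$, and $L_3=U_{\{1\},3}(b,a,c)$. For all $m,n\ge 3$, the state complexities of $K_m^R\cup L_n^R$, $K_m^R\cap L_n^R$ and $K_m^R\setminus L_n^R$ are each $(2^m-1)(2^n-1)+1$,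 and that of $K_m^R\oplus L_n^R$ is $2^{m+n-1}$. 2. For all $m,n\ge 3$ with $(m,n)\ne(4,4)$, the state complexities of $U_m(a,b,c)^R\cup U_n(b,a,c)^R$, $U_m(a,b,c)^R\cap U_n(b,a,c)^R$ and $U_m(a,b,c)^R\setminus U_n(b,a,c)^R$ are each $(2^m-1)(2^n-1)+1$, and that of $U_m(a,b,c)^R\oplus U_n(b,a,c)^R$ is $2^{m+n-1}$. For $m=n=4$ the first three are $202$ and the fourth is $116$. -/

import Mathlib

open scoped symmDiff

/-- `HasStateComplexity L k`: the least number of states of a (complete) deterministic finite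
automaton recognizing the language `L` is `k`. -/
def HasStateComplexity {α : Type*} (L : Language α) (k : ℕ) : Prop :=
  IsLeast {j : ℕ | ∃ M : DFA α (Fin j), M.accepts = L} k

/-- The ternary alphabet `{a, b, c}`. -/
inductive Letter
  | a
  | b
  | c

/-- Interchange of the letters `a` and `b`. -/
def Letter.swapAB : Letter → Letter
  | .a => .b
  | .b => .a
  | .c => .c

/-- The automaton `𝒰_{F,n}(a,b,c)` with states `0, …, n - 1`, initial state `0` and set of final
states `F` (more precisely, the states whose number lies in `F`): the letter `a` acts as the cycle
`(0, …, n - 1)`, `b` as the transposition `(0, 1)`, and `c` sends `n - 1` to `0` and fixes all the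
other states. -/
def universalDFA (F : Set ℕ) (n : ℕ) (hn : 3 ≤ n) : DFA Letter (Fin n) where
  step q
    | .a => ⟨(q + 1) % n, Nat.mod_lt _ (by omega)⟩
    | .b => Equiv.swap ⟨0, by omega⟩ ⟨1, by omega⟩ q
    | .c => if (q : ℕ) = n - 1 then ⟨0, by omega⟩ else q
  start := ⟨0, by omega⟩
  accept := {q | (q : ℕ) ∈ F}

/-- The language `U_{F,n}(a,b,c)` of `𝒰_{F,n}(a,b,c)`. -/
def langABC (F : Set ℕ) (n : ℕ) (hn : 3 ≤ n) : Language Letter :=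
  (universalDFA F n hn).accepts

/-- The language `U_{F,n}(b,a,c)` of the automaton `𝒰_{F,n}(b,a,c)`, obtained from
`𝒰_{F,n}(a,b,c)` by interchanging the roles of the letters `a` and `b`. -/
def langBAC (F : Set ℕ) (n : ℕ) (hn : 3 ≤ n) : Language Letter :=
  ((universalDFA F n hn).comap Letter.swapAB).accepts

/-- `K_m = U_{{0,2},m}(a,b,c)`. -/
def witnessK (m : ℕ) (hm : 3 ≤ m) : Language Letter :=
  langABC {0, 2} m hm

/-- `L_n = U_{{1,3},n}(b,a,c)` for `n ≥ 4`, and `L_3 = U_{{1},3}(b,a,c)`. -/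
def witnessL (n : ℕ) (hn : 3 ≤ n) : Language Letter :=
  langBAC (if n = 3 then {1} else {1, 3}) n hn

/-- The universal witness `U_n(a,b,c)`, whose only final state is `n - 1`. -/
def standardABC (n : ℕ) (hn : 3 ≤ n) : Language Letter :=
  langABC {n - 1} n hn

/-- The language `U_n(b,a,c)`, whose automaton has the only final state `n - 1`. -/
def standardBAC (n : ℕ) (hn : 3 ≤ n) : Language Letter :=
  langBAC {n - 1} n hn

/-! By Myhill–Nerode, state complexity is the number of left quotients. Let `M`, `N` be the two
automata. Reading a word `w` in reverse takes the pair of final sets to a pair `(S, T)` of state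
sets (`reversePairs`). The corresponding quotient of the combined reversals is determined by the
subset `combine f (S, T)` of the product of the state sets. If all pairs of states are reachable in
the direct product, distinct subsets give distinct quotients
(`ncard_range_leftQuotient_of_reverse`), so only the sets `combine f (S, T)` need counting.

For intersection these sets are the rectangles `S × T`: nonempty ones determine their sides, and all
the others are empty, hence `(2^m - 1)(2^n - 1) + 1` when every pair occurs. Complementing one or
both sides reduces union and difference to this case. For symmetric difference, exactly `(S, T)` and
`(Sᶜ, Tᶜ)` coincide, hence `2^(m+n-1)`.

It remains to reach every `(S, T)`. The letters `a`, `b` act on the pair of state sets by (cycle,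
transposition) and (transposition, cycle). Unless `m = n = 4`, the group they generate contains `A_m
× A_n` (`mk_mem_of_not_both_four`). This is transitive on subsets of each size, so only the two
cardinalities matter, and `c`, applied to well-placed sets, changes one cardinality by one and keeps
the other (`forall_of_alternatingGroup_of_merge`). Starting from nonempty proper final sets, every
pair of sizes is reached.

For `m = n = 4` the Klein four-group obstructs the group argument, and the 256 pairs are searched by
kernel computation. -/

theorem hasStateComplexity_of_ncard_leftQuotient {α : Type*} {L : Language α} {k : ℕ} (hk : 0 < k)
    (h : (Set.range L.leftQuotient).ncard = k) : HasStateComplexity L k := by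
  constructor
  · have hfin : (Set.range L.leftQuotient).Finite := Set.finite_of_ncard_pos (h ▸ hk)
    have : Finite (Set.range L.leftQuotient) := hfin
    have hcard : Nat.card (Set.range L.leftQuotient) = k := h
    exact ⟨DFA.reindex (Finite.equivFinOfCardEq hcard) L.toDFA, by simp⟩
  · rintro j ⟨M, rfl⟩
    rw [← h, Language.leftQuotient_accepts]
    calc (Set.range (M.acceptsFrom ∘ M.eval)).ncard
        ≤ (Set.range M.acceptsFrom).ncard :=
          Set.ncard_le_ncard (Set.range_comp_subset_range _ _) (Set.toFinite _)
      _ ≤ (Set.univ : Set (Fin j)).ncard := by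
          rw [← Set.image_univ]; exact Set.ncard_image_le (Set.toFinite _)
      _ = j := by simp

/-! ### Quotients of combined reversals as subsets of the product of the state sets -/

section Quotients

variable {α σ τ : Type*}

/-- The pairs of state sets reached by the product of the subset automata of the reversals of `M`
and `N`. -/
def reversePairs (M : DFA α σ) (N : DFA α τ) : Set (Set σ × Set τ) :=
  Set.range fun w : List α => ({q | M.evalFrom q w ∈ M.accept}, {q | N.evalFrom q w ∈ N.accept})

theorem accept_mem_reversePairs (M : DFA α σ) (N : DFA α τ) :
    (M.accept, N.accept) ∈ reversePairs M N := ⟨[], by simp⟩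

theorem preimage_step_mem_reversePairs {M : DFA α σ} {N : DFA α τ} {S : Set σ} {T : Set τ}
    (h : (S, T) ∈ reversePairs M N) (x : α) :
    ((M.step · x) ⁻¹' S, (N.step · x) ⁻¹' T) ∈ reversePairs M N := by
  obtain ⟨w, hw⟩ := h
  obtain ⟨rfl, rfl⟩ := Prod.mk.inj hw
  exact ⟨x :: w, by simp⟩

/-- The set of pairs `(x, y)` such that `f (x ∈ S) (y ∈ T)`. -/
def combine (f : Prop → Prop → Prop) (P : Set σ × Set τ) : Set (σ × τ) :=
  {p | f (p.1 ∈ P.1) (p.2 ∈ P.2)}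

/-- The quotient by `w` consists of the `v` for which `v.reverse` leads the direct product from its
start into a set depending on `w`. Reachability of all pairs of states makes this set recoverable
from the quotient. -/
theorem ncard_range_leftQuotient_of_reverse {M : DFA α σ} {N : DFA α τ}
    (hreach : ∀ x y, ∃ w, M.eval w = x ∧ N.eval w = y) (f : Prop → Prop → Prop) {L : Language α}
    (hL : ∀ w, w ∈ L ↔ f (w ∈ M.accepts.reverse) (w ∈ N.accepts.reverse)) :
    (Set.range L.leftQuotient).ncard = (combine f '' reversePairs M N).ncard := by
  let g : Set (σ × τ) → Language α := fun X => {v | (M.eval v.reverse, N.eval v.reverse) ∈ X}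
  have hg : Function.Injective g := by
    intro X Y hXY
    ext ⟨x, y⟩
    obtain ⟨w, rfl, rfl⟩ := hreach x y
    have := Set.ext_iff.mp hXY w.reverse
    simpa [g] using this
  rw [← Set.ncard_image_of_injective _ hg, Set.image_image, reversePairs, ← Set.range_comp]
  have key : ∀ w, L.leftQuotient w =
      g (combine f ({q | M.evalFrom q w.reverse ∈ M.accept},
        {q | N.evalFrom q w.reverse ∈ N.accept})) := by
    intro w
    ext v
    change w ++ v ∈ L ↔ f (M.evalFrom (M.eval v.reverse) w.reverse ∈ M.accept)
      (N.evalFrom (N.eval v.reverse) w.reverse ∈ N.accept)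
    rw [hL, Language.mem_reverse, Language.mem_reverse, List.reverse_append, DFA.mem_accepts,
      DFA.mem_accepts, DFA.eval, DFA.eval, DFA.evalFrom_of_append, DFA.evalFrom_of_append]
  congr 1
  ext X
  constructor
  · rintro ⟨w, rfl⟩
    exact ⟨w.reverse, (key w).symm⟩
  · rintro ⟨w, rfl⟩
    exact ⟨w.reverse, by simp [key]⟩

end Quotients

/-! ### Counting the combined sets for each Boolean operation -/

section Counting

variable {σ τ : Type*} {R : Set (Set σ × Set τ)}

/-- A nonempty rectangle determines its sides; all pairs with an empty side collapse to the single
set `∅`, which accounts for the `+ 1`. -/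
theorem ncard_image_combine_and [Finite σ] [Finite τ] (hR : (∅, ∅) ∈ R) :
    (combine And '' R).ncard = (R ∩ {P | P.1.Nonempty ∧ P.2.Nonempty}).ncard + 1 := by
  have hprod : ∀ P : Set σ × Set τ, combine And P = P.1 ×ˢ P.2 := fun P => rfl
  have himage : combine And '' R =
      insert ∅ (combine And '' (R ∩ {P | P.1.Nonempty ∧ P.2.Nonempty})) := by
    ext X
    constructor
    · rintro ⟨P, hP, rfl⟩
      by_cases h : P.1.Nonempty ∧ P.2.Nonempty
      · exact Or.inr ⟨P, ⟨hP, h⟩, rfl⟩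
      · left
        rwa [hprod, ← Set.not_nonempty_iff_eq_empty, Set.prod_nonempty_iff]
    · rintro (rfl | ⟨P, hP, rfl⟩)
      · exact ⟨_, hR, by simp [hprod]⟩
      · exact ⟨P, hP.1, rfl⟩
  rw [himage, Set.ncard_insert_of_notMem, Set.InjOn.ncard_image]
  · rintro P ⟨-, hP⟩ Q ⟨-, hQ⟩ h
    rw [hprod, hprod, Set.prod_eq_prod_iff_of_nonempty (hP.1.prod hP.2)] at h
    exact Prod.ext h.1 h.2
  · rintro ⟨P, ⟨-, hP⟩, h⟩
    exact (hP.1.prod hP.2).ne_empty h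

theorem image_combine_or (h₁ : ∀ S T, (S, T) ∈ R → (Sᶜ, T) ∈ R)
    (h₂ : ∀ S T, (S, T) ∈ R → (S, Tᶜ) ∈ R) :
    combine Or '' R = compl '' (combine And '' R) := by
  rw [Set.image_image]
  ext X
  constructor <;>
  · rintro ⟨⟨S, T⟩, hP, rfl⟩
    refine ⟨(Sᶜ, Tᶜ), h₂ _ _ (h₁ _ _ hP), ?_⟩
    ext p
    simp [combine]
    tauto

theorem image_combine_and_not (h₂ : ∀ S T, (S, T) ∈ R → (S, Tᶜ) ∈ R) :
    combine (fun p q => p ∧ ¬q) '' R = combine And '' R := by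
  ext X
  constructor <;>
  · rintro ⟨⟨S, T⟩, hP, rfl⟩
    refine ⟨(S, Tᶜ), h₂ _ _ hP, ?_⟩
    ext p
    simp [combine]

/-- Equality says that `P.1`, `Q.1` agree at `x` exactly when `P.2`, `Q.2` agree at `y`, for all `x`
and `y`. Hence agreement is constant: everywhere or nowhere. -/
theorem combine_xor_eq_iff [Nonempty σ] [Nonempty τ] {P Q : Set σ × Set τ} :
    combine Xor P = combine Xor Q ↔ Q = P ∨ Q = (P.1ᶜ, P.2ᶜ) := by
  constructor
  · intro h
    have h' : ∀ x y, (x ∈ P.1 ↔ x ∈ Q.1) ↔ (y ∈ P.2 ↔ y ∈ Q.2) := by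
      intro x y
      have := Set.ext_iff.mp h (x, y)
      simp only [combine, xor_def, Set.mem_ofPred_eq] at this
      tauto
    obtain ⟨x₀⟩ := ‹Nonempty σ›
    obtain ⟨y₀⟩ := ‹Nonempty τ›
    by_cases hx : x₀ ∈ P.1 ↔ x₀ ∈ Q.1
    · left
      have hy := (h' x₀ y₀).mp hx
      exact Prod.ext (Set.ext fun x => ((h' x y₀).mpr hy).symm)
        (Set.ext fun y => ((h' x₀ y).mp hx).symm)
    · right
      have hy := (h' x₀ y₀).not.mp hx
      refine Prod.ext (Set.ext fun x => ?_) (Set.ext fun y => ?_)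
      · have := (h' x y₀).not.mpr hy
        simp only [Set.mem_compl_iff]
        tauto
      · have := (h' x₀ y).not.mp hx
        simp only [Set.mem_compl_iff]
        tauto
  · rintro (rfl | rfl)
    · rfl
    · ext p
      simp only [combine, xor_def, Set.mem_ofPred_eq, Set.mem_compl_iff]
      tauto

theorem two_mul_ncard_image_combine_xor [Finite σ] [Finite τ] [Nonempty σ] [Nonempty τ]
    (h : ∀ S T, (S, T) ∈ R → (Sᶜ, Tᶜ) ∈ R) :
    2 * (combine Xor '' R).ncard = R.ncard := by
  obtain ⟨x₀⟩ := ‹Nonempty σ›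
  -- Complementing both sides is an involution exchanging `A` and `B`, so `A` contains one
  -- representative of each class.
  set A := {P ∈ R | x₀ ∈ P.1}
  set B := {P ∈ R | x₀ ∉ P.1}
  let κ : Set σ × Set τ → Set σ × Set τ := fun P => (P.1ᶜ, P.2ᶜ)
  have hκ : Function.Involutive κ := fun P => by simp [κ]
  have hB : B = κ '' A := by
    ext P
    constructor
    · rintro ⟨hP, hx⟩
      exact ⟨κ P, ⟨h _ _ hP, hx⟩, hκ P⟩
    · rintro ⟨Q, ⟨hQ, hx⟩, rfl⟩
      exact ⟨h _ _ hQ, by simpa [κ] using hx⟩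
  have hR : R = A ∪ B := by
    ext P
    simp only [A, B, Set.mem_union, Set.mem_ofPred_eq]
    tauto
  have hdisj : Disjoint A B := Set.disjoint_left.mpr fun P hA hB => hB.2 hA.2
  have himage : combine Xor '' R = combine Xor '' A := by
    refine Set.Subset.antisymm ?_ (Set.image_mono fun P hP => hP.1)
    rintro _ ⟨P, hP, rfl⟩
    by_cases hx : x₀ ∈ P.1
    · exact ⟨P, ⟨hP, hx⟩, rfl⟩
    · exact ⟨κ P, ⟨h _ _ hP, hx⟩, (combine_xor_eq_iff.mpr (Or.inr rfl)).symm⟩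
  have hinj : Set.InjOn (combine Xor) A := by
    rintro P ⟨-, hP⟩ Q ⟨-, hQ⟩ hPQ
    rcases combine_xor_eq_iff.mp hPQ with rfl | rfl
    · rfl
    · exact absurd hP hQ
  rw [himage, hinj.ncard_image, hR, Set.ncard_union_eq hdisj, hB,
    Set.ncard_image_of_injective _ hκ.injective, two_mul]

end Counting

/-- `HasBooleanComplexities K L k l`: the union, the intersection and the difference of the
languages `K` and `L` have state complexity `k`, and their symmetric difference has `l`. -/
def HasBooleanComplexities {α : Type*} (K L : Language α) (k l : ℕ) : Prop :=
  HasStateComplexity (K ⊔ L) k ∧ HasStateComplexity (K ⊓ L) k ∧ HasStateComplexity (K \ L) k ∧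
    HasStateComplexity (K ∆ L) l

theorem hasBooleanComplexities_reverse {α σ τ : Type*} [Finite σ] [Finite τ]
    {M : DFA α σ} {N : DFA α τ} (hreach : ∀ x y, ∃ w, M.eval w = x ∧ N.eval w = y)
    (h₀ : (∅, ∅) ∈ reversePairs M N)
    (h₁ : ∀ S T, (S, T) ∈ reversePairs M N → (Sᶜ, T) ∈ reversePairs M N)
    (h₂ : ∀ S T, (S, T) ∈ reversePairs M N → (S, Tᶜ) ∈ reversePairs M N) {k l : ℕ}
    (hk : (reversePairs M N ∩ {P | P.1.Nonempty ∧ P.2.Nonempty}).ncard = k)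
    (hl : (reversePairs M N).ncard = 2 * l) :
    HasBooleanComplexities M.accepts.reverse N.accepts.reverse (k + 1) l := by
  have : Nonempty σ := ⟨M.start⟩
  have : Nonempty τ := ⟨N.start⟩
  have hcard := ncard_image_combine_and h₀
  rw [hk] at hcard
  have hxor := two_mul_ncard_image_combine_xor
    (fun S T h => h₂ _ _ (h₁ S T h) : ∀ S T, (S, T) ∈ reversePairs M N → _)
  have hlpos : 0 < (reversePairs M N).ncard := (Set.ncard_pos).mpr ⟨_, h₀⟩
  refine ⟨?_, ?_, ?_, ?_⟩
  · refine hasStateComplexity_of_ncard_leftQuotient k.succ_pos ?_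
    rw [ncard_range_leftQuotient_of_reverse hreach Or
      (L := M.accepts.reverse ⊔ N.accepts.reverse) fun w => Iff.rfl, image_combine_or h₁ h₂,
      Set.ncard_image_of_injective _ compl_injective, hcard]
  · refine hasStateComplexity_of_ncard_leftQuotient k.succ_pos ?_
    rw [ncard_range_leftQuotient_of_reverse hreach And
      (L := M.accepts.reverse ⊓ N.accepts.reverse) fun w => Iff.rfl, hcard]
  · refine hasStateComplexity_of_ncard_leftQuotient k.succ_pos ?_
    rw [ncard_range_leftQuotient_of_reverse hreach (fun p q => p ∧ ¬q)
      (L := M.accepts.reverse \ N.accepts.reverse) fun w => Iff.rfl,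
      image_combine_and_not h₂, hcard]
  · refine hasStateComplexity_of_ncard_leftQuotient (by omega) ?_
    rw [ncard_range_leftQuotient_of_reverse hreach Xor
      (L := M.accepts.reverse ∆ N.accepts.reverse) fun w => Iff.rfl]
    omega

theorem ncard_setOf_nonempty (σ : Type*) [Fintype σ] :
    {S : Set σ | S.Nonempty}.ncard = 2 ^ Fintype.card σ - 1 := by
  have : {S : Set σ | S.Nonempty} = {∅}ᶜ := by
    ext S
    simp [Set.nonempty_iff_ne_empty]
  rw [this, Set.ncard_compl, Set.ncard_singleton, Nat.card_eq_fintype_card, Fintype.card_set]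

theorem hasBooleanComplexities_of_reversePairs_eq_univ {α σ τ : Type*} [Fintype σ] [Fintype τ]
    {M : DFA α σ} {N : DFA α τ} (hreach : ∀ x y, ∃ w, M.eval w = x ∧ N.eval w = y)
    (h : reversePairs M N = Set.univ) :
    HasBooleanComplexities M.accepts.reverse N.accepts.reverse
      ((2 ^ Fintype.card σ - 1) * (2 ^ Fintype.card τ - 1) + 1)
      (2 ^ (Fintype.card σ + Fintype.card τ - 1)) := by
  have : 0 < Fintype.card σ := Fintype.card_pos_iff.mpr ⟨M.start⟩
  apply hasBooleanComplexities_reverse hreach <;> rw [h]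
  · trivial
  · exact fun _ _ _ => trivial
  · exact fun _ _ _ => trivial
  · have : (Set.univ ∩ {P | P.1.Nonempty ∧ P.2.Nonempty} : Set (Set σ × Set τ)) =
        {S | S.Nonempty} ×ˢ {T | T.Nonempty} := by
      ext P
      simp
    rw [this, Set.ncard_prod, ncard_setOf_nonempty, ncard_setOf_nonempty]
  · rw [Set.ncard_univ, Nat.card_prod, Nat.card_eq_fintype_card, Nat.card_eq_fintype_card,
      Fintype.card_set, Fintype.card_set, ← pow_add, ← pow_succ']
    congr 1
    omega

/-! ### The permutation group generated by `a` and `b` -/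

section Group

open Equiv Equiv.Perm

/-- The transposition `(0, 1)` of `Fin n`. -/
def swapZeroOne (n : ℕ) (hn : 3 ≤ n) : Perm (Fin n) :=
  swap ⟨0, by omega⟩ ⟨1, by omega⟩

theorem finRotate_apply_mk {n : ℕ} {i : ℕ} (hi : i < n) :
    finRotate n ⟨i, hi⟩ = ⟨(i + 1) % n, Nat.mod_lt _ (by omega)⟩ := by
  obtain _ | n := n
  · omega
  · rw [finRotate_apply]
    ext
    simp [Fin.val_add]

theorem closure_finRotate_swapZeroOne {n : ℕ} (hn : 3 ≤ n) :
    Subgroup.closure {finRotate n, swapZeroOne n hn} = ⊤ := by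
  have h := closure_cycle_adjacent_swap (isCycle_finRotate_of_le (by omega : 2 ≤ n))
    (support_finRotate_of_le (by omega)) ⟨0, by omega⟩
  rw [finRotate_apply_mk] at h
  simpa [swapZeroOne, Nat.mod_eq_of_lt (by omega : 1 < n)] using h

variable {m n : ℕ} {hm : 3 ≤ m} {hn : 3 ≤ n} {G : Subgroup (Perm (Fin m) × Perm (Fin n))}

theorem exists_mk_mem (ha : (finRotate m, swapZeroOne n hn) ∈ G)
    (hb : (swapZeroOne m hm, finRotate n) ∈ G) (g : Perm (Fin m)) : ∃ q, (g, q) ∈ G := by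
  have h : Subgroup.closure {finRotate m, swapZeroOne m hm} ≤ G.map (MonoidHom.fst _ _) := by
    rw [Subgroup.closure_le]
    rintro _ (rfl | rfl)
    · exact ⟨_, ha, rfl⟩
    · exact ⟨_, hb, rfl⟩
  rw [closure_finRotate_swapZeroOne] at h
  obtain ⟨⟨p, q⟩, hpq, rfl⟩ := h (Subgroup.mem_top g)
  exact ⟨q, hpq⟩

/-- Since `G` projects onto the whole symmetric group, conjugating `(t, 1)` within `G` yields `(s,
1)` for every conjugate `s` of `t`, that is, for all three-cycles; these generate the alternating
group. -/
theorem mk_one_mem_of_isThreeCycle (ha : (finRotate m, swapZeroOne n hn) ∈ G)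
    (hb : (swapZeroOne m hm, finRotate n) ∈ G) {t : Perm (Fin m)} (ht : t.IsThreeCycle)
    (htG : (t, 1) ∈ G) {p : Perm (Fin m)} (hp : p ∈ alternatingGroup (Fin m)) : (p, 1) ∈ G := by
  have h : Subgroup.closure {s : Perm (Fin m) | s.IsThreeCycle} ≤ G.comap (MonoidHom.inl _ _) := by
    rw [Subgroup.closure_le]
    intro s hs
    obtain ⟨g, rfl⟩ := isConj_iff.mp (isConj_iff_cycleType_eq.mpr (Eq.trans ht (Eq.symm hs)))
    obtain ⟨q, hq⟩ := exists_mk_mem ha hb g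
    simpa using G.mul_mem (G.mul_mem hq htG) (G.inv_mem hq)
  rw [closure_three_cycles_eq_alternating] at h
  exact h hp

/-- Squaring the first generator kills its transposition, leaving `(r², 1)` with `r` the cycle. For
`m = 3`, `r²` is a three-cycle; for `m ≥ 5` a commutator with it is one. For `m = 4`, `r²` lies in
the Klein four-group, whose normality defeats this argument. -/
theorem mk_one_mem_of_ne_four (ha : (finRotate m, swapZeroOne n hn) ∈ G)
    (hb : (swapZeroOne m hm, finRotate n) ∈ G) (hm4 : m ≠ 4) {p : Perm (Fin m)}
    (hp : p ∈ alternatingGroup (Fin m)) : (p, 1) ∈ G := by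
  have haa : (finRotate m * finRotate m, 1) ∈ G := by
    simpa [swapZeroOne] using G.mul_mem ha ha
  rcases (by omega : m = 3 ∨ 5 ≤ m) with rfl | hm5
  · refine mk_one_mem_of_isThreeCycle ha hb ?_ haa hp
    have : finRotate 3 * finRotate 3 = swap (0 : Fin 3) 1 * swap 0 2 := by decide
    rw [this]
    exact isThreeCycle_swap_mul_swap_same (by decide) (by decide) (by decide)
  · obtain ⟨q, hq⟩ := exists_mk_mem ha hb (swap ⟨0, by omega⟩ ⟨2, by omega⟩)
    -- The commutator of `(r², 1)` and `((0 2), q)`: `q` cancels, and the first coordinate is `(2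
    -- 4)(0 2)`, a three-cycle because `4 < m`.
    have h := G.mul_mem (G.mul_mem (G.mul_mem haa hq) (G.inv_mem haa)) (G.inv_mem hq)
    simp only [Prod.mk_mul_mk, Prod.inv_mk, inv_one, mul_one, one_mul, mul_inv_cancel,
      swap_inv] at h
    refine mk_one_mem_of_isThreeCycle ha hb ?_ h hp
    rw [← Equiv.swap_apply_apply, Perm.mul_apply, Perm.mul_apply]
    simp only [finRotate_apply_mk, Nat.zero_add, Nat.reduceAdd,
      Nat.mod_eq_of_lt (by omega : 1 < m), Nat.mod_eq_of_lt (by omega : 2 < m),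
      Nat.mod_eq_of_lt (by omega : 3 < m), Nat.mod_eq_of_lt (by omega : 4 < m)]
    rw [swap_comm (⟨0, by omega⟩ : Fin m)]
    exact isThreeCycle_swap_mul_swap_same (by simp) (by simp) (by simp)

theorem one_mk_mem_of_ne_four (ha : (finRotate m, swapZeroOne n hn) ∈ G)
    (hb : (swapZeroOne m hm, finRotate n) ∈ G) (hn4 : n ≠ 4) {q : Perm (Fin n)}
    (hq : q ∈ alternatingGroup (Fin n)) : (1, q) ∈ G :=
  mk_one_mem_of_ne_four (G := G.comap (MulEquiv.prodComm (M := Perm (Fin n)) (N := Perm (Fin m))).toMonoidHom)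
    (hm := hn) (hn := hm) hb ha hn4 hq

theorem mk_one_mem_of_not_both_four (ha : (finRotate m, swapZeroOne n hn) ∈ G)
    (hb : (swapZeroOne m hm, finRotate n) ∈ G) (hmn : ¬(m = 4 ∧ n = 4)) {p : Perm (Fin m)}
    (hp : p ∈ alternatingGroup (Fin m)) : (p, 1) ∈ G := by
  by_cases hm4 : m = 4
  · subst hm4
    -- With `m = 4` and `n ≠ 4`, the other factor already gives `1 × A_n ≤ G`, and squares are even.
    -- The product of the generators is a three-cycle in the first coordinate; so is its square,
    -- whose second coordinate can now be cancelled.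
    have hsq : ∀ q : Perm (Fin n), (1, q * q) ∈ G := fun q =>
      one_mk_mem_of_ne_four ha hb (fun h => hmn ⟨rfl, h⟩) (by simp [mem_alternatingGroup])
    have h := G.mul_mem ha hb
    have h' := G.mul_mem (G.mul_mem h h) (G.inv_mem (hsq (swapZeroOne n hn * finRotate n)))
    simp only [Prod.mk_mul_mk, Prod.inv_mk, inv_one, mul_one, mul_inv_cancel] at h'
    refine mk_one_mem_of_isThreeCycle ha hb ?_ h' hp
    have : ∀ h, finRotate 4 * swapZeroOne 4 h * (finRotate 4 * swapZeroOne 4 h) =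
        swap (0 : Fin 4) 2 * swap 0 3 := by
      decide
    rw [this]
    exact isThreeCycle_swap_mul_swap_same (by decide) (by decide) (by decide)
  · exact mk_one_mem_of_ne_four ha hb hm4 hp

theorem mk_mem_of_not_both_four (ha : (finRotate m, swapZeroOne n hn) ∈ G)
    (hb : (swapZeroOne m hm, finRotate n) ∈ G) (hmn : ¬(m = 4 ∧ n = 4)) {p : Perm (Fin m)}
    (hp : p ∈ alternatingGroup (Fin m)) {q : Perm (Fin n)} (hq : q ∈ alternatingGroup (Fin n)) :
    (p, q) ∈ G := by
  have h₁ := mk_one_mem_of_not_both_four ha hb hmn hp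
  have h₂ : (1, q) ∈ G :=
    mk_one_mem_of_not_both_four (G := G.comap (MulEquiv.prodComm (M := Perm (Fin n)) (N := Perm (Fin m))).toMonoidHom)
      (hm := hn) (hn := hm) hb ha (fun h => hmn h.symm) hq
  simpa using G.mul_mem h₁ h₂

end Group

/-! ### Transitivity of the alternating group on subsets of equal size -/

section Homogeneous

open Equiv

variable {V : Type*} [Fintype V] [DecidableEq V]

/-- The alternating group on at least three points acts transitively on the subsets of each
cardinality. -/
theorem exists_mem_alternatingGroup_preimage_eq (hV : 3 ≤ Fintype.card V) {S T : Set V}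
    (h : S.ncard = T.ncard) : ∃ p ∈ alternatingGroup V, p ⁻¹' S = T := by
  classical
  obtain ⟨e⟩ : Nonempty (T ≃ S) := Finite.card_eq.mp h.symm
  obtain ⟨p, hp⟩ : ∃ p : Perm V, p ⁻¹' S = T := by
    refine ⟨e.extendSubtype, ?_⟩
    ext x
    by_cases hx : x ∈ T
    · simpa [hx] using e.extendSubtype_mem x hx
    · simpa [hx] using e.extendSubtype_not_mem x hx
  -- Among three points, two lie on the same side of `S`; their transposition preserves `S` and
  -- corrects the sign of an odd `p`.
  obtain ⟨x, y, hxy, hmem⟩ : ∃ x y : V, x ≠ y ∧ (x ∈ S ↔ y ∈ S) := by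
    by_contra! hne
    obtain ⟨x, y, z, hxy, hxz, hyz⟩ := Fintype.two_lt_card_iff.mp hV
    have h₁ := hne x y hxy
    have h₂ := hne x z hxz
    have h₃ := hne y z hyz
    tauto
  rcases Int.units_eq_one_or (Perm.sign p) with hs | hs
  · exact ⟨p, by simpa using hs, hp⟩
  · refine ⟨swap x y * p, by simp [hs, Perm.sign_swap hxy], ?_⟩
    rw [← hp]
    ext z
    simp only [Perm.coe_mul, Set.mem_preimage, Function.comp_apply]
    rw [swap_apply_def]
    split_ifs with h₁ h₂
    · rw [h₁, hmem]
    · rw [h₂, hmem]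
    · rfl

end Homogeneous

/-! ### Changing cardinalities with the letter `c` -/

section Merge

variable {V W : Type*}

/-- The map that sends `w` to `z` and fixes all the other points. -/
def merge [DecidableEq V] (z w : V) (q : V) : V := if q = w then z else q

theorem preimage_merge_of_mem [DecidableEq V] {z w : V} {S : Set V} (hz : z ∈ S) :
    merge z w ⁻¹' S = insert w S := by
  ext q
  by_cases h : q = w <;> simp [merge, h, hz]

theorem preimage_merge_of_notMem [DecidableEq V] {z w : V} {S : Set V} (hz : z ∉ S) :
    merge z w ⁻¹' S = S \ {w} := by
  ext q
  by_cases h : q = w <;> simp [merge, h, hz]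

theorem preimage_merge_of_mem_iff [DecidableEq V] {z w : V} {S : Set V} (h : z ∈ S ↔ w ∈ S) :
    merge z w ⁻¹' S = S := by
  ext q
  by_cases hq : q = w <;> simp [merge, hq, h]

theorem exists_ncard_eq_mem_notMem [Fintype V] {z w : V} (hzw : z ≠ w) {S : Set V}
    (h₁ : S.Nonempty) (h₂ : S ≠ Set.univ) : ∃ A : Set V, A.ncard = S.ncard ∧ z ∈ A ∧ w ∉ A := by
  have hS : 1 ≤ S.ncard := (Set.ncard_pos).mpr h₁
  have hS' : S.ncard < Nat.card V := by
    rw [← Set.ncard_univ]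
    exact Set.ncard_lt_ncard (Set.ssubset_univ_iff.mpr h₂)
  obtain ⟨A, hA, hA', hcard⟩ := Set.exists_subsuperset_card_eq (s := {z}) (t := {w}ᶜ)
    (by simpa using hzw.symm) (n := S.ncard) (by simpa using hS)
    (by rw [Set.ncard_compl, Set.ncard_singleton]; omega)
  exact ⟨A, hcard, by simpa using hA, fun hw => hA' hw rfl⟩

theorem exists_ncard_eq_mem_iff_mem [Fintype V] (hV : 3 ≤ Fintype.card V) (z w : V) (S : Set V) :
    ∃ A : Set V, A.ncard = S.ncard ∧ (z ∈ A ↔ w ∈ A) := by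
  have hpair : ({z, w} : Set V).ncard ≤ 2 :=
    (Set.ncard_insert_le _ _).trans (by simp)
  have hle : S.ncard ≤ Nat.card V := by
    rw [← Set.ncard_univ]
    exact Set.ncard_le_ncard (Set.subset_univ S)
  have hc : Nat.card V = Fintype.card V := Nat.card_eq_fintype_card
  by_cases h : 2 ≤ S.ncard
  · obtain ⟨A, hA, -, hcard⟩ := Set.exists_subsuperset_card_eq (s := {z, w}) (t := Set.univ)
      (Set.subset_univ _) (n := S.ncard) (by omega) (by rwa [Set.ncard_univ])
    exact ⟨A, hcard, by simp [hA (by simp : z ∈ _), hA (by simp : w ∈ _)]⟩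
  · obtain ⟨A, -, hA, hcard⟩ := Set.exists_subsuperset_card_eq (s := ∅) (t := {z, w}ᶜ)
      (Set.empty_subset _) (n := S.ncard) (by simp) (by rw [Set.ncard_compl]; omega)
    refine ⟨A, hcard, iff_of_false (fun hz => hA hz (by simp)) fun hw => hA hw (by simp)⟩

variable [Fintype V] [Fintype W] [DecidableEq V] [DecidableEq W] {z w : V} {z' w' : W} {Reach : Set V → Set W → Prop}

/-- By `hcard` only sizes matter. Put the second set in a position where its merge does nothing, and
the first so that exactly one of `z`, `w` belongs to it: the merge then adds or removes `w`. A
nonempty proper set can be so placed, so all sizes are reached step by step, including the empty and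
the full set. -/
theorem forall_left_of_ncard_of_merge (hW : 3 ≤ Fintype.card W) (hzw : z ≠ w)
    (hcard : ∀ S T S' T', Reach S T → S.ncard = S'.ncard → T.ncard = T'.ncard → Reach S' T')
    (hmerge : ∀ S T, Reach S T → Reach (merge z w ⁻¹' S) (merge z' w' ⁻¹' T))
    {S : Set V} {T : Set W} (h : Reach S T) (h₁ : S.Nonempty) (h₂ : S ≠ Set.univ) (S' : Set V) :
    Reach S' T := by
  have hS : 1 ≤ S.ncard := (Set.ncard_pos).mpr h₁
  have hS' : S.ncard < Nat.card V := by
    rw [← Set.ncard_univ]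
    exact Set.ncard_lt_ncard (Set.ssubset_univ_iff.mpr h₂)
  obtain ⟨B, hB, hB'⟩ := exists_ncard_eq_mem_iff_mem hW z' w' T
  have hstep : ∀ A, A.Nonempty → A ≠ Set.univ → Reach A T → ∃ A', A'.ncard = A.ncard ∧ z ∈ A' ∧
      w ∉ A' ∧ Reach A' B := fun A hA hA' hr => by
    obtain ⟨A', hc, hz, hw⟩ := exists_ncard_eq_mem_notMem hzw hA hA'
    exact ⟨A', hc, hz, hw, hcard _ _ _ _ hr hc.symm hB.symm⟩
  have hup : ∀ d, ∀ C : Set V, C.ncard = S.ncard + d → Reach C T := by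
    intro d
    induction d with
    | zero => exact fun C hC => hcard _ _ _ _ h hC.symm rfl
    | succ d ih =>
      intro C hC
      obtain ⟨x, hx⟩ : C.Nonempty := (Set.ncard_pos).mp (by omega)
      have hCx : (C \ {x}).ncard = S.ncard + d := by
        rw [Set.ncard_sdiff_singleton_of_mem hx]; omega
      obtain ⟨A, hA, hz, hw, hr⟩ := hstep (C \ {x}) ((Set.ncard_pos).mp (by omega))
        (fun he => (he ▸ Set.mem_univ x : x ∈ C \ {x}).2 rfl) (ih _ hCx)
      have hr' := hmerge _ _ hr
      rw [preimage_merge_of_mem hz, preimage_merge_of_mem_iff hB'] at hr'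
      refine hcard _ _ _ _ hr' ?_ hB
      rw [Set.ncard_insert_of_notMem hw]
      omega
  have hdown : ∀ d, ∀ C : Set V, C.ncard + d = S.ncard → Reach C T := by
    intro d
    induction d with
    | zero => exact fun C hC => hcard _ _ _ _ h hC.symm rfl
    | succ d ih =>
      intro C hC
      obtain ⟨x, hx⟩ : ∃ x, x ∉ C := by
        by_contra! hne
        rw [Set.eq_univ_iff_forall.mpr hne, Set.ncard_univ] at hC
        omega
      have hCx : (insert x C).ncard = C.ncard + 1 := Set.ncard_insert_of_notMem hx
      obtain ⟨A, hA, hA'⟩ : ∃ A : Set V, A.ncard = C.ncard + 1 ∧ z ∉ A ∧ w ∈ A := by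
        obtain ⟨A, hA, hw, hz⟩ := exists_ncard_eq_mem_notMem hzw.symm
          (S := insert x C) ⟨x, by simp⟩ (fun he => by
            rw [he, Set.ncard_univ] at hCx
            omega)
        exact ⟨A, hA.trans hCx, hz, hw⟩
      have hr := hmerge _ _ (hcard _ _ A B (ih _ (by omega)) (hCx.trans hA.symm) hB.symm)
      rw [preimage_merge_of_notMem hA'.1, preimage_merge_of_mem_iff hB'] at hr
      refine hcard _ _ _ _ hr ?_ hB
      rw [Set.ncard_sdiff_singleton_of_mem hA'.2]
      omega
  rcases le_total S.ncard S'.ncard with hle | hle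
  · exact hup (S'.ncard - S.ncard) S' (by omega)
  · exact hdown (S.ncard - S'.ncard) S' (by omega)

theorem forall_of_alternatingGroup_of_merge (hV : 3 ≤ Fintype.card V) (hW : 3 ≤ Fintype.card W)
    (hzw : z ≠ w) (hzw' : z' ≠ w')
    (halt : ∀ p ∈ alternatingGroup V, ∀ q ∈ alternatingGroup W, ∀ S T, Reach S T →
      Reach (p ⁻¹' S) (q ⁻¹' T))
    (hmerge : ∀ S T, Reach S T → Reach (merge z w ⁻¹' S) (merge z' w' ⁻¹' T))
    {S : Set V} {T : Set W} (h : Reach S T) (hS : S.Nonempty) (hS' : S ≠ Set.univ)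
    (hT : T.Nonempty) (hT' : T ≠ Set.univ) (S' : Set V) (T' : Set W) : Reach S' T' := by
  have hcard : ∀ S T S' T', Reach S T → S.ncard = S'.ncard → T.ncard = T'.ncard →
      Reach S' T' := by
    intro S T S' T' hr h₁ h₂
    obtain ⟨p, hp, rfl⟩ := exists_mem_alternatingGroup_preimage_eq hV h₁
    obtain ⟨q, hq, rfl⟩ := exists_mem_alternatingGroup_preimage_eq hW h₂
    exact halt p hp q hq S T hr
  -- The second set is varied first, while `S` is still nonempty and proper; varying the first then
  -- needs nothing of `T'`.
  have hST' : Reach S T' :=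
    forall_left_of_ncard_of_merge (Reach := fun T S => Reach S T) hV hzw'
      (fun T S T' S' hr h₁ h₂ => hcard S T S' T' hr h₂ h₁) (fun T S hr => hmerge S T hr) h hT hT' T'
  exact forall_left_of_ncard_of_merge hW hzw hcard hmerge hST' hS hS' S'

end Merge

/-! ### Reachability of all pairs of states and of state sets -/

section Reachability

open Equiv

/-- A property of the elements of a finite group that holds for `1` and is preserved by
multiplication defines a subgroup. -/
def subgroupOfFinite {H : Type*} [Group H] [Finite H] (P : H → Prop) (one : P 1)
    (mul : ∀ g h, P g → P h → P (g * h)) : Subgroup H where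
  carrier := {g | P g}
  one_mem' := one
  mul_mem' := mul _ _
  inv_mem' {g} hg := by
    have hpow : ∀ k : ℕ, P (g ^ k) := fun k => by
      induction k with
      | zero => simpa using one
      | succ k ih => rw [pow_succ]; exact mul _ _ ih hg
    have h : g⁻¹ = g ^ (orderOf g - 1) := by
      rw [inv_eq_iff_mul_eq_one, ← pow_succ', Nat.sub_add_cancel (orderOf_pos g),
        pow_orderOf_eq_one]
    change P g⁻¹
    rw [h]
    exact hpow _

theorem universalDFA_step_a {F : Set ℕ} {n : ℕ} {hn : 3 ≤ n} : ((universalDFA F n hn).step · .a) = finRotate n :=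
  funext fun q => (finRotate_apply_mk q.2).symm

theorem universalDFA_step_c {F : Set ℕ} {n : ℕ} {hn : 3 ≤ n} :
    ((universalDFA F n hn).step · .c) = merge ⟨0, by omega⟩ ⟨n - 1, by omega⟩ := by
  funext q
  simp [universalDFA, merge, Fin.ext_iff]

variable {F F' : Set ℕ} {m n : ℕ} {hm : 3 ≤ m} {hn : 3 ≤ n}

theorem forall_exists_eval_eq (hmn : ¬(m = 4 ∧ n = 4)) (x : Fin m) (y : Fin n) :
    ∃ w, (universalDFA F m hm).eval w = x ∧
      ((universalDFA F' n hn).comap Letter.swapAB).eval w = y := by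
  set M := universalDFA F m hm
  set N := (universalDFA F' n hn).comap Letter.swapAB
  let P : Fin m → Fin n → Prop := fun x y => ∃ w, M.eval w = x ∧ N.eval w = y
  have hstep : ∀ (l : Letter) x y, P x y → P (M.step x l) (N.step y l) := by
    rintro l _ _ ⟨w, rfl, rfl⟩
    exact ⟨w ++ [l], by simp, by simp⟩
  -- Words only give closure under products; finiteness supplies the inverses.
  let G : Subgroup (Perm (Fin m) × Perm (Fin n)) :=
    subgroupOfFinite (fun g => ∀ x y, P x y → P (g.1 x) (g.2 y)) (fun _ _ h => h)
      fun g h hg hh x y hxy => hg _ _ (hh x y hxy)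
  have ha : (finRotate m, swapZeroOne n hn) ∈ G := fun x y hxy => by
    have := hstep .a x y hxy
    rwa [congrFun universalDFA_step_a x] at this
  have hb : (swapZeroOne m hm, finRotate n) ∈ G := fun x y hxy => by
    have := hstep .b x y hxy
    rwa [show N.step y .b = finRotate n y from
      congrFun (universalDFA_step_a (F := F') (hn := hn)) y] at this
  have htrans : ∀ {k : ℕ}, 3 ≤ k → ∀ i j : Fin k, ∃ p ∈ alternatingGroup (Fin k), p i = j := by
    intro k hk i j
    obtain ⟨p, hp, h⟩ := exists_mem_alternatingGroup_preimage_eq (V := Fin k) (by simpa using hk)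
      (S := {j}) (T := {i}) (by simp)
    exact ⟨p, hp, (h ▸ rfl : i ∈ p ⁻¹' {j})⟩
  obtain ⟨p, hp, rfl⟩ := htrans hm M.start x
  obtain ⟨q, hq, rfl⟩ := htrans hn N.start y
  exact mk_mem_of_not_both_four ha hb hmn hp hq _ _ ⟨[], rfl, rfl⟩

theorem reversePairs_eq_univ (hmn : ¬(m = 4 ∧ n = 4))
    (hF : ∃ i < m, i ∈ F) (hF₂ : ∃ i < m, i ∉ F) (hF' : ∃ i < n, i ∈ F') (hF₂' : ∃ i < n, i ∉ F') :
    reversePairs (universalDFA F m hm) ((universalDFA F' n hn).comap Letter.swapAB) =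
      Set.univ := by
  set M := universalDFA F m hm
  set N := (universalDFA F' n hn).comap Letter.swapAB
  let G : Subgroup (Perm (Fin m) × Perm (Fin n)) :=
    subgroupOfFinite (fun g => ∀ S T, (S, T) ∈ reversePairs M N →
      (g.1 ⁻¹' S, g.2 ⁻¹' T) ∈ reversePairs M N) (fun _ _ h => h)
      -- Preimages reverse composition, so `g` is applied before `h`.
      fun g h hg hh S T hST => hh _ _ (hg S T hST)
  have ha : (finRotate m, swapZeroOne n hn) ∈ G := fun S T hST => by
    have := preimage_step_mem_reversePairs hST .a
    rwa [show (M.step · .a) = _ from universalDFA_step_a (F := F) (hn := hm)] at this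
  have hb : (swapZeroOne m hm, finRotate n) ∈ G := fun S T hST => by
    have := preimage_step_mem_reversePairs hST .b
    rwa [show (N.step · .b) = finRotate n from
      universalDFA_step_a (F := F') (hn := hn)] at this
  obtain ⟨i, him, hi⟩ := hF
  obtain ⟨i₂, him₂, hi₂⟩ := hF₂
  obtain ⟨j, hjn, hj⟩ := hF'
  obtain ⟨j₂, hjn₂, hj₂⟩ := hF₂'
  rw [Set.eq_univ_iff_forall]
  rintro ⟨S, T⟩
  refine forall_of_alternatingGroup_of_merge (Reach := fun S T => (S, T) ∈ reversePairs M N)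
    (z := (⟨0, by omega⟩ : Fin m)) (w := ⟨m - 1, by omega⟩)
    (z' := (⟨0, by omega⟩ : Fin n)) (w' := ⟨n - 1, by omega⟩)
    (by simpa using hm) (by simpa using hn) (by rw [Ne, Fin.mk.injEq]; omega)
    (by rw [Ne, Fin.mk.injEq]; omega)
    (fun p hp q hq => mk_mem_of_not_both_four ha hb hmn hp hq) ?_ (accept_mem_reversePairs M N)
    ⟨⟨i, him⟩, hi⟩ ?_ ⟨⟨j, hjn⟩, hj⟩ ?_ S T
  · intro S T hST
    have := preimage_step_mem_reversePairs hST .c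
    rwa [show (M.step · .c) = _ from universalDFA_step_c (F := F) (hn := hm),
      show (N.step · .c) = _ from universalDFA_step_c (F := F') (hn := hn)] at this
  · exact fun h => hi₂ (h ▸ Set.mem_univ _ : (⟨i₂, him₂⟩ : Fin m) ∈ M.accept)
  · exact fun h => hj₂ (h ▸ Set.mem_univ _ : (⟨j₂, hjn₂⟩ : Fin n) ∈ N.accept)

theorem hasBooleanComplexities_universalDFA (hmn : ¬(m = 4 ∧ n = 4))
    (hF : ∃ i < m, i ∈ F) (hF₂ : ∃ i < m, i ∉ F) (hF' : ∃ i < n, i ∈ F') (hF₂' : ∃ i < n, i ∉ F') :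
    HasBooleanComplexities (langABC F m hm).reverse (langBAC F' n hn).reverse
      ((2 ^ m - 1) * (2 ^ n - 1) + 1) (2 ^ (m + n - 1)) := by
  have := hasBooleanComplexities_of_reversePairs_eq_univ (forall_exists_eval_eq hmn)
    (reversePairs_eq_univ (hm := hm) (hn := hn) hmn hF hF₂ hF' hF₂')
  rw [Fintype.card_fin, Fintype.card_fin] at this
  exact this

end Reachability

/-! ### A verified search on bit masks -/

section Explore

/-- Mark the number `c` as visited and put it on the stack, unless it is already marked. -/
def visit (vs : ℕ × List ℕ) (c : ℕ) : ℕ × List ℕ :=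
  if vs.1.testBit c then vs else (vs.1 ||| 2 ^ c, c :: vs.2)

/-- Depth-first search: the bits of the result are the numbers found from the given stack. -/
def explore (next : ℕ → List ℕ) : ℕ → ℕ × List ℕ → ℕ
  | k + 1, (v, c :: s) => explore next k ((next c).foldl visit (v, s))
  | _, (v, _) => v

/-- Soundness for any amount of fuel. Completeness is not needed: the computed value of the search
is compared with the expected mask. -/
theorem of_testBit_explore {next : ℕ → List ℕ} {P : ℕ → Prop}
    (hnext : ∀ c, P c → ∀ d ∈ next c, P d) (k : ℕ) (vs : ℕ × List ℕ)
    (hv : ∀ c, vs.1.testBit c → P c) (hs : ∀ c ∈ vs.2, P c) {c : ℕ}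
    (hc : (explore next k vs).testBit c) : P c := by
  induction k generalizing vs with
  | zero => exact hv c hc
  | succ k ih =>
    obtain ⟨v, _ | ⟨d, s⟩⟩ := vs
    · exact hv c hc
    · have hfold : ∀ (l : List ℕ) (vs : ℕ × List ℕ), (∀ e ∈ l, P e) →
          (∀ c, vs.1.testBit c → P c) → (∀ c ∈ vs.2, P c) →
          (∀ c, (l.foldl visit vs).1.testBit c → P c) ∧ ∀ c ∈ (l.foldl visit vs).2, P c := by
        intro l
        induction l with
        | nil => exact fun vs _ h₁ h₂ => ⟨h₁, h₂⟩
        | cons e l ihl =>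
          intro vs hl h₁ h₂
          have he : P e := hl e (by simp)
          refine ihl (visit vs e) (fun f hf => hl f (by simp [hf])) ?_ ?_
          · intro f hf
            unfold visit at hf
            split_ifs at hf
            · exact h₁ f hf
            · rw [Nat.testBit_or, Bool.or_eq_true] at hf
              rcases hf with hf | hf
              · exact h₁ f hf
              · rw [Nat.testBit_two_pow, decide_eq_true_eq] at hf
                exact hf ▸ he
          · intro f hf
            unfold visit at hf
            split_ifs at hf
            · exact h₂ f hf
            · rcases List.mem_cons.mp hf with rfl | hf
              · exact he
              · exact h₂ f hf
      have h := hfold (next d) (v, s) (hnext d (hs d (by simp))) hv fun e he => hs e (by simp [he])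
      exact ih _ h.1 h.2 hc

end Explore

/-! ### The case `m = n = 4` -/

section Four

/-- The pair of subsets of `Fin 4` given by the bits `0, …, 3` and `4, …, 7` of a number. -/
def decodePair (c : ℕ) : Set (Fin 4) × Set (Fin 4) :=
  ({i | c.testBit i}, {i | c.testBit (i + 4)})

theorem decodePair_ofBits (f g : Fin 4 → Bool) :
    decodePair (Nat.ofBits (Fin.append f g)) = ({i | f i}, {i | g i}) := by
  refine Prod.ext (Set.ext fun i => ?_) (Set.ext fun i => ?_)
  · have h : (Nat.ofBits (Fin.append f g)).testBit i = f i := by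
      rw [Nat.testBit_ofBits_lt _ _ (by omega)]
      exact Fin.append_left f g i
    simp [decodePair, h]
  · have h : (Nat.ofBits (Fin.append f g)).testBit (i + 4) = g i := by
      rw [Nat.testBit_ofBits_lt _ _ (by omega), ← Fin.append_right f g i]
      congr 1
      ext
      simp
    simp [decodePair, h]

theorem exists_decodePair_eq (P : Set (Fin 4) × Set (Fin 4)) : ∃ c < 256, decodePair c = P := by
  classical
  refine ⟨_, Nat.ofBits_lt_two_pow (Fin.append (fun i => decide (i ∈ P.1))
    fun i => decide (i ∈ P.2)), ?_⟩
  rw [decodePair_ofBits]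
  simp

theorem injOn_decodePair : Set.InjOn decodePair {c | c < 256} := by
  intro c hc d hd h
  obtain ⟨h₁, h₂⟩ := Prod.mk.inj h
  refine Nat.eq_of_testBit_eq fun i => ?_
  by_cases hi : i < 4
  · have h : c.testBit i = true ↔ d.testBit i = true := Set.ext_iff.mp h₁ ⟨i, hi⟩
    exact Bool.eq_iff_iff.mpr h
  by_cases hi' : i < 8
  · have h : c.testBit (i - 4 + 4) = true ↔ d.testBit (i - 4 + 4) = true :=
      Set.ext_iff.mp h₂ ⟨i - 4, by omega⟩
    rw [Nat.sub_add_cancel (not_lt.mp hi)] at h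
    exact Bool.eq_iff_iff.mpr h
  · have : 2 ^ 8 ≤ 2 ^ i := Nat.pow_le_pow_right (by norm_num) (by omega)
    rw [Nat.testBit_lt_two_pow (lt_of_lt_of_le hc this),
      Nat.testBit_lt_two_pow (lt_of_lt_of_le hd this)]

theorem decodePair_xor_fifteen (c : ℕ) :
    decodePair (c ^^^ 15) = ((decodePair c).1ᶜ, (decodePair c).2) := by
  have h₁ : ∀ i : Fin 4, Nat.testBit 15 i = true := by decide
  have h₂ : ∀ i : Fin 4, Nat.testBit 15 (i + 4) = false := by decide
  refine Prod.ext (Set.ext fun i => ?_) (Set.ext fun i => ?_)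
  · simp [decodePair, Nat.testBit_xor, h₁]
  · simp [decodePair, Nat.testBit_xor, h₂]

theorem decodePair_xor_two_hundred_forty (c : ℕ) :
    decodePair (c ^^^ 240) = ((decodePair c).1, (decodePair c).2ᶜ) := by
  have h₁ : ∀ i : Fin 4, Nat.testBit 240 i = false := by decide
  have h₂ : ∀ i : Fin 4, Nat.testBit 240 (i + 4) = true := by decide
  refine Prod.ext (Set.ext fun i => ?_) (Set.ext fun i => ?_)
  · simp [decodePair, Nat.testBit_xor, h₁]
  · simp [decodePair, Nat.testBit_xor, h₂]

/-- The number whose pair of sets is obtained by the letter `l` from that of `c`. -/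
def nextCode (h : 3 ≤ 4) (l : Letter) (c : ℕ) : ℕ :=
  Nat.ofBits (Fin.append
    (fun i : Fin 4 => c.testBit ((universalDFA ∅ 4 h).step i l))
    fun i : Fin 4 => c.testBit ((universalDFA ∅ 4 h).step i l.swapAB + 4))

theorem nextCode_lt (h : 3 ≤ 4) (l : Letter) (c : ℕ) : nextCode h l c < 256 :=
  Nat.ofBits_lt_two_pow _

/-- The numbers obtained from `c` by the three letters. -/
def nextCodes (c : ℕ) : List ℕ :=
  [nextCode (by decide) .a c, nextCode (by decide) .b c, nextCode (by decide) .c c]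

variable {F F' : Set ℕ} {h : 3 ≤ 4}

theorem decodePair_nextCode_mem {l : Letter} {c : ℕ}
    (hc : decodePair c ∈ reversePairs (universalDFA F 4 h)
      ((universalDFA F' 4 h).comap Letter.swapAB)) :
    decodePair (nextCode h l c) ∈ reversePairs (universalDFA F 4 h)
      ((universalDFA F' 4 h).comap Letter.swapAB) := by
  rw [nextCode, decodePair_ofBits]
  exact preimage_step_mem_reversePairs hc l

theorem decodePair_mem_of_testBit_explore {k c₀ c : ℕ}
    (h₀ : decodePair c₀ = ((universalDFA F 4 h).accept, (universalDFA F' 4 h).accept))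
    (hc : (explore nextCodes k (0, [c₀])).testBit c) :
    decodePair c ∈ reversePairs (universalDFA F 4 h)
      ((universalDFA F' 4 h).comap Letter.swapAB) := by
  refine of_testBit_explore (P := fun c => decodePair c ∈ reversePairs (universalDFA F 4 h)
    ((universalDFA F' 4 h).comap Letter.swapAB)) ?_ k (0, [c₀]) (by simp) ?_ hc
  · intro d hd e he
    simp only [nextCodes, List.mem_cons, List.not_mem_nil, or_false] at he
    rcases he with rfl | rfl | rfl <;> exact decodePair_nextCode_mem hd
  · simp only [List.mem_singleton, forall_eq]
    rw [h₀]
    exact accept_mem_reversePairs _ ((universalDFA F' 4 h).comap Letter.swapAB)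

theorem forall_exists_eval_eq_four (x y : Fin 4) :
    ∃ w, (universalDFA F 4 h).eval w = x ∧
      ((universalDFA F' 4 h).comap Letter.swapAB).eval w = y := by
  -- Words `a^i b^j a^k` suffice. Final states do not affect transitions, so `∅` replaces `F` and
  -- `F'` to make the claim decidable.
  have key : ∀ x y : Fin 4, ∃ i j k : Fin 4, ∀ h : 3 ≤ 4,
      let w := List.replicate i .a ++ List.replicate j .b ++ List.replicate k Letter.a
      w.foldl (universalDFA ∅ 4 h).step ⟨0, by decide⟩ = x ∧
        w.foldl ((universalDFA ∅ 4 h).comap Letter.swapAB).step ⟨0, by decide⟩ = y := by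
    decide +kernel
  obtain ⟨i, j, k, hw⟩ := key x y
  exact ⟨_, hw h⟩

theorem hasBooleanComplexities_witness_four :
    HasBooleanComplexities (langABC {0, 2} 4 h).reverse (langBAC {1, 3} 4 h).reverse
      ((2 ^ 4 - 1) * (2 ^ 4 - 1) + 1) (2 ^ (4 + 4 - 1)) := by
  -- `165 = 0b10100101` encodes `({0, 2}, {1, 3})`. The initial code is unmarked on the stack and
  -- may be pushed once more, hence fuel `256 + 1`.
  have hexp : explore nextCodes 257 (0, [165]) = 2 ^ 256 - 1 := by decide +kernel
  have := hasBooleanComplexities_of_reversePairs_eq_univ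
    (forall_exists_eval_eq_four (F := {0, 2}) (F' := {1, 3}) (h := h)) (by
      rw [Set.eq_univ_iff_forall]
      intro P
      obtain ⟨c, hc, rfl⟩ := exists_decodePair_eq P
      refine decodePair_mem_of_testBit_explore (k := 257) (c₀ := 165) ?_ ?_
      · refine Prod.ext (Set.ext fun i => ?_) (Set.ext fun i => ?_) <;>
          fin_cases i <;> simp [decodePair, universalDFA] <;> decide
      · rw [hexp, Nat.testBit_two_pow_sub_one]
        simpa using hc)
  rw [Fintype.card_fin] at this
  exact this

/-- The bits of this number are the numbers whose pairs of sets are reachable in the product of the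
subset automata of the reversals of `𝒰_4(a,b,c)` and `𝒰_4(b,a,c)`. -/
def standardCodes : ℕ :=
  0xffffffffffffedb7fffff99febd7ffffffffebd7f99fffffedb7ffffffffffff

theorem testBit_nextCode_standardCodes : ∀ (l : Letter), ∀ c < 256, standardCodes.testBit c →
    standardCodes.testBit (nextCode h l c) := by
  have key : ∀ l ∈ [Letter.a, .b, .c], ∀ h, ∀ c < 256, standardCodes.testBit c →
      standardCodes.testBit (nextCode h l c) := by decide +kernel
  rintro (_ | _ | _) <;> exact key _ (by simp) h

/-- The 24 pairs missing from `standardCodes` consist of two-element sets. A two-element set splits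
the four points into two pairs, in one of three ways. The actions of `a` and `b` preserve a
bijection between the splittings on the two sides, and `c` yields two-element sets only with the
splitting `{0, 3}`, `{1, 2}` on both sides, which corresponds to itself. Hence, from `({3}, {3})`,
pairs with non-corresponding splittings are never reached. -/
theorem reversePairs_standard_four :
    reversePairs (universalDFA {4 - 1} 4 h) ((universalDFA {4 - 1} 4 h).comap Letter.swapAB) =
      decodePair '' {c | c < 256 ∧ standardCodes.testBit c} := by
  -- `136 = 0b10001000` encodes `({3}, {3})`.
  have h₀ : decodePair 136 =
      ((universalDFA {4 - 1} 4 h).accept, (universalDFA {4 - 1} 4 h).accept) := by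
    refine Prod.ext (Set.ext fun i => ?_) (Set.ext fun i => ?_) <;>
      fin_cases i <;> simp [decodePair, universalDFA] <;> decide
  refine Set.Subset.antisymm ?_ ?_
  · rintro _ ⟨w, rfl⟩
    induction w with
    | nil => exact ⟨136, ⟨by norm_num, by decide +kernel⟩, h₀⟩
    | cons l w ih =>
      obtain ⟨c, ⟨hc, hc'⟩, hcw⟩ := ih
      refine ⟨nextCode h l c, ⟨nextCode_lt h l c, testBit_nextCode_standardCodes l c hc hc'⟩, ?_⟩
      obtain ⟨h₁, h₂⟩ := Prod.mk.inj hcw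
      rw [nextCode, decodePair_ofBits]
      exact Prod.ext (congrArg (((universalDFA {4 - 1} 4 h).step · l) ⁻¹' ·) h₁)
        (congrArg (((universalDFA {4 - 1} 4 h).step · l.swapAB) ⁻¹' ·) h₂)
  · rintro _ ⟨c, ⟨-, hc⟩, rfl⟩
    have hexp : explore nextCodes 257 (0, [136]) = standardCodes := by decide +kernel
    exact decodePair_mem_of_testBit_explore h₀ (hexp ▸ hc)

theorem ncard_image_decodePair (p : ℕ → Prop) [DecidablePred p] :
    (decodePair '' {c | c < 256 ∧ p c}).ncard = ((Finset.range 256).filter p).card := by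
  rw [(injOn_decodePair.mono fun c hc => hc.1).ncard_image, ← Set.ncard_coe_finset]
  congr 1
  ext c
  simp

/-- Of the 256 pairs, 232 = 2 · 116 are reached; 31 of them have an empty side, which leaves 201,
and the empty rectangle makes 202. -/
theorem hasBooleanComplexities_standard_four :
    HasBooleanComplexities (standardABC 4 h).reverse (standardBAC 4 h).reverse 202 116 := by
  refine hasBooleanComplexities_reverse (k := 201) forall_exists_eval_eq_four ?_ ?_ ?_ ?_ ?_ <;>
    rw [reversePairs_standard_four]
  · exact ⟨0, ⟨by norm_num, by decide +kernel⟩, by simp [decodePair]⟩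
  · rintro S T ⟨c, ⟨hc, hc'⟩, hST⟩
    refine ⟨c ^^^ 15, ⟨Nat.xor_lt_two_pow (n := 8) hc (by norm_num), ?_⟩, ?_⟩
    · exact (by decide +kernel : ∀ c < 256, standardCodes.testBit c →
        standardCodes.testBit (c ^^^ 15)) c hc hc'
    · rw [decodePair_xor_fifteen, hST]
  · rintro S T ⟨c, ⟨hc, hc'⟩, hST⟩
    refine ⟨c ^^^ 240, ⟨Nat.xor_lt_two_pow (n := 8) hc (by norm_num), ?_⟩, ?_⟩
    · exact (by decide +kernel : ∀ c < 256, standardCodes.testBit c →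
        standardCodes.testBit (c ^^^ 240)) c hc hc'
    · rw [decodePair_xor_two_hundred_forty, hST]
  · have : decodePair '' {c | c < 256 ∧ standardCodes.testBit c} ∩
        {P | P.1.Nonempty ∧ P.2.Nonempty} = decodePair '' {c | c < 256 ∧ standardCodes.testBit c ∧
          (∃ i : Fin 4, c.testBit i) ∧ ∃ i : Fin 4, c.testBit (i + 4)} := by
      ext P
      constructor
      · rintro ⟨⟨c, hc, rfl⟩, hP⟩
        exact ⟨c, ⟨hc.1, hc.2, hP⟩, rfl⟩
      · rintro ⟨c, ⟨hc, hc', hP⟩, rfl⟩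
        exact ⟨⟨c, ⟨hc, hc'⟩, rfl⟩, hP⟩
    rw [this, ncard_image_decodePair]
    decide +kernel
  · rw [ncard_image_decodePair]
    decide +kernel

end Four

theorem mainTheorem1 :
    (∀ (m n : ℕ) (hm : 3 ≤ m) (hn : 3 ≤ n),
      HasStateComplexity ((witnessK m hm).reverse ⊔ (witnessL n hn).reverse)
        ((2 ^ m - 1) * (2 ^ n - 1) + 1) ∧
      HasStateComplexity ((witnessK m hm).reverse ⊓ (witnessL n hn).reverse)
        ((2 ^ m - 1) * (2 ^ n - 1) + 1) ∧
      HasStateComplexity ((witnessK m hm).reverse \ (witnessL n hn).reverse)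
        ((2 ^ m - 1) * (2 ^ n - 1) + 1) ∧
      HasStateComplexity ((witnessK m hm).reverse ∆ (witnessL n hn).reverse)
        (2 ^ (m + n - 1))) ∧
    (∀ (m n : ℕ) (hm : 3 ≤ m) (hn : 3 ≤ n), ¬(m = 4 ∧ n = 4) →
      HasStateComplexity ((standardABC m hm).reverse ⊔ (standardBAC n hn).reverse)
        ((2 ^ m - 1) * (2 ^ n - 1) + 1) ∧
      HasStateComplexity ((standardABC m hm).reverse ⊓ (standardBAC n hn).reverse)
        ((2 ^ m - 1) * (2 ^ n - 1) + 1) ∧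
      HasStateComplexity ((standardABC m hm).reverse \ (standardBAC n hn).reverse)
        ((2 ^ m - 1) * (2 ^ n - 1) + 1) ∧
      HasStateComplexity ((standardABC m hm).reverse ∆ (standardBAC n hn).reverse)
        (2 ^ (m + n - 1))) ∧
    (∀ h : (3 : ℕ) ≤ 4,
      HasStateComplexity ((standardABC 4 h).reverse ⊔ (standardBAC 4 h).reverse) 202 ∧
      HasStateComplexity ((standardABC 4 h).reverse ⊓ (standardBAC 4 h).reverse) 202 ∧
      HasStateComplexity ((standardABC 4 h).reverse \ (standardBAC 4 h).reverse) 202 ∧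
      HasStateComplexity ((standardABC 4 h).reverse ∆ (standardBAC 4 h).reverse) 116) := by
  refine ⟨fun m n hm hn => ?_, fun m n hm hn hmn => ?_, fun h => ?_⟩
  · by_cases hmn : m = 4 ∧ n = 4
    · obtain ⟨rfl, rfl⟩ := hmn
      have := hasBooleanComplexities_witness_four (h := hm)
      simp only [witnessK, witnessL, Nat.reduceEqDiff, if_false]
      exact this
    · refine hasBooleanComplexities_universalDFA hmn ⟨0, by omega, by simp⟩ ⟨1, by omega, by simp⟩
        ⟨1, by omega, ?_⟩ ⟨0, by omega, ?_⟩ <;> split_ifs <;> simp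
  · exact hasBooleanComplexities_universalDFA hmn ⟨m - 1, by omega, rfl⟩
      ⟨0, by omega, by rw [Set.mem_singleton_iff]; omega⟩ ⟨n - 1, by omega, rfl⟩
      ⟨0, by omega, by rw [Set.mem_singleton_iff]; omega⟩
  · exact hasBooleanComplexities_standard_four
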